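/- Let $T$ be the regular binary rooted tree, whose vertices are the finite words over $X=\{1,2\}$. Let $\mathrm{Aut}(T)$ be its group of root-preserving automorphisms, acting on the left, with the congruence topology, in which the level stabilizers $\mathrm{St}(n)$ form a base of neighbourhoods of the identity. Let $\sigma$ be the transposition of the two letters, and for $g_1,g_2\in\mathrm{Aut}(T)$ and $\pi\in\{1,\sigma\}$ let $g=(g_1,g_2)\pi$ denote the automorphism with $g(xw)=\pi(x)\,g_x(w)$ for every letter $x$ and every word $w$. Consider the $4$-state invertible automaton over $X$ with states $a,b,c,d$ given by $$a=(a,c)\sigma,\qquad b=(d,d),\qquad c=(d,b),\qquad d=(a,c),$$ and let $G=\langle a,b,c,d\rangle\le\mathrm{Aut}(T)$ be the group that it generates. Let $\Gamma=\langle a',b',c',d'\rangle\le\mathrm{Aut}(T)$ be the first Grigorchuk group, where $a'=(1,1)\sigma$, $b'=(a',c')$, $c'=(a',d')$ and $d'=(1,b')$. Then $\Gamma\le G$; the groups $G$ and $\Gamma$ have the same closure in $\mathrm{Aut}(T)$; $G$ is not a torsion group; and $\Gamma$ has infinite index in $G$. -/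

import Mathlib

namespace GrigBrother

/-- The regular rooted tree whose vertices are the finite words over the alphabet `X`: the root is
the empty word, and the children of the word `v` are the words `v ++ [x]` for `x : X`. -/
def regularTree (X : Type*) : SimpleGraph (List X) where
  Adj v w := (∃ x, w = v ++ [x]) ∨ (∃ x, v = w ++ [x])
  symm := ⟨fun _ _ h => h.symm⟩
  loopless := ⟨fun v h => by
    rcases h with ⟨x, h⟩ | ⟨x, h⟩ <;> exact absurd (congrArg List.length h) (by simp)⟩

/-- The graph automorphisms of the regular rooted tree that fix the root. The product is
composition of maps, so the action on the tree is a left action. -/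
def rootedAut (X : Type*) : Subgroup (regularTree X ≃g regularTree X) where
  carrier := {g | g [] = []}
  one_mem' := rfl
  mul_mem' := fun {g h} hg hh => by
    change g (h []) = []
    rw [show h [] = [] from hh]
    exact hg
  inv_mem' := fun {g} hg => by
    change g.symm [] = []
    rw [RelIso.symm_apply_eq]
    exact Eq.symm hg

/-- The group `Aut(T)` of automorphisms of the regular rooted tree `T` of words over `X`. -/
def TreeAut (X : Type*) : Type _ := ↥(rootedAut X)

instance (X : Type*) : Group (TreeAut X) := inferInstanceAs (Group ↥(rootedAut X))

/-- The image of the vertex `v` under the tree automorphism `g`. -/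
def TreeAut.act {X : Type*} (g : TreeAut X) (v : List X) : List X := g.1 v

namespace TreeAut

variable {X : Type*}

@[simp] theorem one_act (v : List X) : (1 : TreeAut X).act v = v := rfl

@[simp] theorem mul_act (g h : TreeAut X) (v : List X) : (g * h).act v = g.act (h.act v) := rfl

@[simp] theorem act_nil (g : TreeAut X) : g.act [] = [] := g.2

@[simp] theorem inv_act_act (g : TreeAut X) (v : List X) : g⁻¹.act (g.act v) = v := by
  rw [← mul_act, inv_mul_cancel, one_act]

@[simp] theorem act_inv_act (g : TreeAut X) (v : List X) : g.act (g⁻¹.act v) = v := by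
  rw [← mul_act, mul_inv_cancel, one_act]

@[ext] theorem ext {g h : TreeAut X} (H : ∀ v, g.act v = h.act v) : g = h :=
  Subtype.ext (RelIso.ext H)

theorem adj_act (g : TreeAut X) (v : List X) (x : X) :
    (regularTree X).Adj (g.act v) (g.act (v ++ [x])) :=
  g.1.map_rel_iff.2 (Or.inl ⟨x, rfl⟩)

/-- Tree automorphisms preserve the levels. -/
theorem length_act (g : TreeAut X) (v : List X) : (g.act v).length = v.length := by
  suffices H : ∀ n : ℕ, ∀ (g : TreeAut X) (v : List X), v.length = n → (g.act v).length = n from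
    H _ g v rfl
  intro n
  induction n using Nat.strong_induction_on with
  | _ n ih =>
    intro g v hv
    rcases List.eq_nil_or_concat' v with rfl | ⟨u, x, rfl⟩
    · simpa using hv
    · have hu : u.length + 1 = n := by simpa using hv
      have hgu := ih u.length (by omega) g u rfl
      rcases adj_act g u x with ⟨y, hy⟩ | ⟨y, hy⟩
      · rw [hy]; simp [hgu, hu]
      · have hl : (g.act (u ++ [x])).length + 1 = u.length := by
          rw [← hgu, hy]; simp
        have h2 := ih _ (by omega) g⁻¹ (g.act (u ++ [x])) rfl
        rw [inv_act_act] at h2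
        omega

theorem act_append_singleton (g : TreeAut X) (v : List X) (x : X) :
    ∃ y, g.act (v ++ [x]) = g.act v ++ [y] := by
  rcases adj_act g v x with h | ⟨y, hy⟩
  · exact h
  · have h := congrArg List.length hy
    simp only [length_act, List.length_append, List.length_singleton] at h
    omega

/-- The stabilizer `St(n)` of level `n`: the automorphisms that fix every vertex at distance `n`
from the root. -/
def levelStabilizer (X : Type*) (n : ℕ) : Subgroup (TreeAut X) where
  carrier := {g | ∀ v : List X, v.length = n → g.act v = v}
  one_mem' := fun _ _ => rfl
  mul_mem' := fun {g h} hg hh v hv => by rw [mul_act, hh v hv, hg v hv]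
  inv_mem' := fun {g} hg v hv => by
    conv_lhs => rw [← hg v hv]
    exact inv_act_act g v

theorem mem_levelStabilizer {n : ℕ} {g : TreeAut X} :
    g ∈ levelStabilizer X n ↔ ∀ v : List X, v.length = n → g.act v = v := Iff.rfl

theorem levelStabilizer_succ_le (n : ℕ) : levelStabilizer X (n + 1) ≤ levelStabilizer X n := by
  intro g hg v hv
  rcases v with _ | ⟨x, w⟩
  · exact act_nil g
  · obtain ⟨y, hy⟩ := act_append_singleton g (x :: w) x
    have h := hg (x :: w ++ [x]) (by simpa using hv)
    rw [hy] at h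
    exact List.append_inj_left' h rfl

theorem levelStabilizer_antitone : Antitone (levelStabilizer X) :=
  antitone_nat_of_succ_le levelStabilizer_succ_le

theorem conj_mem_levelStabilizer (g h : TreeAut X) {n : ℕ} (hh : h ∈ levelStabilizer X n) :
    g * h * g⁻¹ ∈ levelStabilizer X n := by
  intro v hv
  rw [mul_act, mul_act, hh _ ((length_act _ _).trans hv), act_inv_act]

/-- The level stabilizers `St(n)`, as a neighbourhood basis of the identity of `Aut(T)`. -/
def congruenceBasis (X : Type*) : GroupFilterBasis (TreeAut X) where
  sets := Set.range fun n : ℕ => (levelStabilizer X n : Set (TreeAut X))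
  nonempty := ⟨_, 0, rfl⟩
  inter_sets := by
    rintro _ _ ⟨m, rfl⟩ ⟨n, rfl⟩
    exact ⟨_, ⟨max m n, rfl⟩, fun g hg => ⟨levelStabilizer_antitone (le_max_left m n) hg,
      levelStabilizer_antitone (le_max_right m n) hg⟩⟩
  one' := by
    rintro _ ⟨n, rfl⟩
    exact one_mem (levelStabilizer X n)
  mul' := by
    rintro _ ⟨n, rfl⟩
    refine ⟨_, ⟨n, rfl⟩, ?_⟩
    rintro _ ⟨g, hg, h, hh, rfl⟩
    exact mul_mem (S := Subgroup (TreeAut X)) hg hh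
  inv' := by
    rintro _ ⟨n, rfl⟩
    exact ⟨_, ⟨n, rfl⟩, fun g hg => inv_mem (S := Subgroup (TreeAut X)) hg⟩
  conj' := by
    rintro g _ ⟨n, rfl⟩
    exact ⟨_, ⟨n, rfl⟩, fun h hh => conj_mem_levelStabilizer g h hh⟩

/-- The congruence topology on `Aut(T)`. -/
instance : TopologicalSpace (TreeAut X) := (congruenceBasis X).topology

instance : IsTopologicalGroup (TreeAut X) := (congruenceBasis X).isTopologicalGroup

end TreeAut

/-- An automaton with set of states `Q` and alphabet `X`: if `trans (q, x) = (y, r)`, then in the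
state `q` the automaton reads the letter `x`, writes the letter `y` and passes to the state `r`. -/
structure Automaton (Q X : Type*) where
  trans : Q × X → X × Q

namespace Automaton

variable {Q X : Type*} (A : Automaton Q X)

/-- An automaton is invertible if the output function of each state permutes the alphabet. -/
def IsInvertible : Prop := ∀ q : Q, Function.Bijective fun x : X => (A.trans (q, x)).1

/-- The word that the automaton writes when it starts in the given state and reads a word. -/
def run : Q → List X → List X
  | _, [] => []
  | q, x :: w => (A.trans (q, x)).1 :: run (A.trans (q, x)).2 w

theorem length_run (q : Q) (w : List X) : (A.run q w).length = w.length := by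
  induction w generalizing q with
  | nil => rfl
  | cons x w ih => simp [run, ih]

theorem run_append_singleton (q : Q) (w : List X) (x : X) :
    ∃ y, A.run q (w ++ [x]) = A.run q w ++ [y] := by
  induction w generalizing q with
  | nil => exact ⟨_, rfl⟩
  | cons z w ih =>
    obtain ⟨y, hy⟩ := ih (A.trans (q, z)).2
    exact ⟨y, by simp [run, hy]⟩

variable {A}

theorem IsInvertible.run_bijective (hA : A.IsInvertible) (q : Q) :
    Function.Bijective (A.run q) := by
  constructor
  · intro v
    induction v generalizing q with
    | nil =>
      intro w h
      have := congrArg List.length h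
      rw [length_run, length_run] at this
      exact (List.eq_nil_of_length_eq_zero this.symm).symm
    | cons x v ih =>
      intro w h
      rcases w with _ | ⟨y, w⟩
      · simp [run] at h
      · simp only [run, List.cons.injEq] at h
        have hxy : x = y := (hA q).1 h.1
        subst hxy
        rw [ih _ h.2]
  · intro v
    induction v generalizing q with
    | nil => exact ⟨[], rfl⟩
    | cons y v ih =>
      obtain ⟨x, hx⟩ := (hA q).2 y
      obtain ⟨w, hw⟩ := ih (A.trans (q, x)).2
      exact ⟨x :: w, by rw [run, hw]; exact congrArg (· :: v) hx⟩

theorem IsInvertible.adj_run_iff (hA : A.IsInvertible) (q : Q) (v w : List X) :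
    (regularTree X).Adj (A.run q v) (A.run q w) ↔ (regularTree X).Adj v w := by
  have key : ∀ v w : List X, (∃ y, A.run q w = A.run q v ++ [y]) ↔ ∃ x, w = v ++ [x] := by
    intro v w
    constructor
    · rintro ⟨y, hy⟩
      have hl := congrArg List.length hy
      simp only [length_run, List.length_append, List.length_singleton] at hl
      rcases List.eq_nil_or_concat' w with rfl | ⟨u, x, rfl⟩
      · simp at hl
      · obtain ⟨z, hz⟩ := A.run_append_singleton q u x
        rw [hz] at hy
        exact ⟨x, by rw [(hA.run_bijective q).1 (List.append_inj_left' hy rfl)]⟩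
    · rintro ⟨x, rfl⟩
      exact A.run_append_singleton q v x
  exact or_congr (key v w) (key w v)

/-- The automorphism `g_q` of the tree of words defined by the state `q` of an invertible
automaton: it maps a word to the word that the automaton writes on reading it from `q`. -/
noncomputable def stateAut (hA : A.IsInvertible) (q : Q) : TreeAut X :=
  ⟨{ toEquiv := Equiv.ofBijective (A.run q) (hA.run_bijective q)
     map_rel_iff' := hA.adj_run_iff q _ _ }, rfl⟩

theorem stateAut_act (hA : A.IsInvertible) (q : Q) (v : List X) :
    (stateAut hA q).act v = A.run q v := rfl

/-- The group generated by an invertible automaton. -/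
noncomputable def group (hA : A.IsInvertible) : Subgroup (TreeAut X) :=
  Subgroup.closure (Set.range (stateAut hA))

end Automaton

/-! In the two automata below the letters `1`, `2` are the elements `0`, `1` of `Fin 2`. -/

/-- The states of the automaton of the first Grigorchuk group. -/
inductive GrigState
  | e | a | b | c | d

/-- The automaton of the first Grigorchuk group. With `σ` the transposition of the two letters,
its states satisfy `e = 1`, `a = (1, 1)σ`, `b = (a, c)`, `c = (a, d)` and `d = (1, b)`. -/
def grigAutomaton : Automaton GrigState (Fin 2) where
  trans
    | (.e, x) => (x, .e)
    | (.a, 0) => (1, .e)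
    | (.a, 1) => (0, .e)
    | (.b, 0) => (0, .a)
    | (.b, 1) => (1, .c)
    | (.c, 0) => (0, .a)
    | (.c, 1) => (1, .d)
    | (.d, 0) => (0, .e)
    | (.d, 1) => (1, .b)

theorem grigAutomaton_isInvertible : grigAutomaton.IsInvertible := by
  intro q
  rw [← Finite.injective_iff_bijective]
  cases q <;> decide

/-- The first Grigorchuk group. -/
noncomputable def grigorchukGroup : Subgroup (TreeAut (Fin 2)) :=
  Automaton.group grigAutomaton_isInvertible

/-- The states of the four-state automaton. -/
inductive BrotherState
  | a | b | c | d

/-- The four-state automaton. With `σ` the transposition of the two letters, its states satisfy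
`a = (a, c)σ`, `b = (d, d)`, `c = (d, b)` and `d = (a, c)`. -/
def brotherAutomaton : Automaton BrotherState (Fin 2) where
  trans
    | (.a, 0) => (1, .a)
    | (.a, 1) => (0, .c)
    | (.b, 0) => (0, .d)
    | (.b, 1) => (1, .d)
    | (.c, 0) => (0, .d)
    | (.c, 1) => (1, .b)
    | (.d, 0) => (0, .a)
    | (.d, 1) => (1, .c)

theorem brotherAutomaton_isInvertible : brotherAutomaton.IsInvertible := by
  intro q
  rw [← Finite.injective_iff_bijective]
  cases q <;> decide

/-- The group generated by the four-state automaton. -/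
noncomputable def brotherGroup : Subgroup (TreeAut (Fin 2)) :=
  Automaton.group brotherAutomaton_isInvertible

end GrigBrother

/-!
Write `Γ` for the Grigorchuk group with generators `α`, `β`, `γ`, `δ`, and `B` for the state `b` of
the four-state automaton, which generates `G`. Comparing sections, the states `a`, `c`, `d` of that
automaton are `α β B`, `δ B`, `β B`. Hence `G` is generated by `Γ` and `B = (β B, β B)`, and in
particular `Γ ≤ G`.

*Closures.* It suffices that `B` is a limit of elements of `Γ`. Let `K` be the normal closure of
`t = (α β)²` in `Γ`; it contains `(k, 1)` and `(1, k)` for all `k ∈ K`. With `h = (β, β) = (δ α)²`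
one has `(h, h) ∈ K`, so if `B` agrees with some element `h k` of the coset `h K` on a level, then
`B = (β B, β B)` agrees with `(β h k, β h k) = h (h, h) (k, k) ∈ h K` on the next level
(`exists_act_eq_B_act`).

*Torsion.* The conjugates of `β`, `γ`, `δ` by `B` satisfy a closed system of recursions, since `B`
commutes with `α`. By means of it, `g = conjγ α γ conjγ γ` swaps the two letters, a section of `g²`
is conjugate to an element `g'` which again swaps the letters, and a section of `g'²` is conjugate
to `g`. A positive exponent killing `g` is therefore divisible by `4`, and its quarter kills `g` as
well, which is absurd by descent (`conjγ_word_pow_ne_one`).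

*Index.* The sections of an element of `Γ` at all deep vertices lie in the nucleus
`{1, α, β, γ, δ}`. This fails for `conjγ`, which is not in the nucleus and is its own section at
the vertex `222`. As every element of `G` is the second coordinate of an element of `G`, the normal
closure of `t` in `G` contains `(1, y)` together with `y`, hence contains copies of `B t B⁻¹` at
all vertices `2ⁿ`. The quotient of two such copies has a section which is `conjγ⁻¹` up to factors
from `Γ`, so the copies lie in different cosets of `Γ` (`inv_deepConj_mul_notMem`).
-/

namespace GrigBrother

open TreeAut

/-! ### Automorphisms with prescribed sections -/

/-- The automorphism `(g x)ₓ` of the tree that fixes the first level and acts as `g x` on the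
subtree below the letter `x`. -/
def ofSectionsFun {X : Type*} (g : X → TreeAut X) : List X → List X
  | [] => []
  | x :: w => x :: (g x).act w

theorem ofSectionsFun_append {X : Type*} (g : X → TreeAut X) (v : List X) (x : X) :
    ∃ y, ofSectionsFun g (v ++ [x]) = ofSectionsFun g v ++ [y] := by
  rcases v with _ | ⟨z, w⟩
  · exact ⟨x, by simp [ofSectionsFun]⟩
  · obtain ⟨y, hy⟩ := act_append_singleton (g z) w x
    exact ⟨y, by simp [ofSectionsFun, hy]⟩

theorem ofSectionsFun_comp {X : Type*} (g h : X → TreeAut X) (v : List X) :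
    ofSectionsFun g (ofSectionsFun h v) = ofSectionsFun (g * h) v := by
  rcases v with _ | ⟨z, w⟩ <;> simp [ofSectionsFun]

theorem ofSectionsFun_one {X : Type*} (v : List X) :
    ofSectionsFun (1 : X → TreeAut X) v = v := by
  rcases v with _ | ⟨z, w⟩ <;> simp [ofSectionsFun]

theorem ofSectionsFun_adj {X : Type*} (g : X → TreeAut X) {v w : List X}
    (h : (regularTree X).Adj v w) :
    (regularTree X).Adj (ofSectionsFun g v) (ofSectionsFun g w) := by
  rcases h with ⟨x, rfl⟩ | ⟨x, rfl⟩
  · exact Or.inl (ofSectionsFun_append g _ x)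
  · exact Or.inr (ofSectionsFun_append g _ x)

/-- The automorphism `(g, h)` of the binary tree, with sections `g` and `h` at the two letters
and trivial action on the first level. -/
def pair (g h : TreeAut (Fin 2)) : TreeAut (Fin 2) :=
  ⟨{ toFun := ofSectionsFun ![g, h]
     invFun := ofSectionsFun (![g, h])⁻¹
     left_inv := fun v => by rw [ofSectionsFun_comp, inv_mul_cancel, ofSectionsFun_one]
     right_inv := fun v => by rw [ofSectionsFun_comp, mul_inv_cancel, ofSectionsFun_one]
     map_rel_iff' := fun {v w} => ⟨fun H => by
       have := ofSectionsFun_adj (![g, h])⁻¹ H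
       simpa only [Equiv.coe_fn_mk, ofSectionsFun_comp, inv_mul_cancel, ofSectionsFun_one]
         using this, ofSectionsFun_adj _⟩ }, rfl⟩

@[simp] theorem pair_act_zero (g h : TreeAut (Fin 2)) (w : List (Fin 2)) :
    (pair g h).act (0 :: w) = 0 :: g.act w := rfl

@[simp] theorem pair_act_one (g h : TreeAut (Fin 2)) (w : List (Fin 2)) :
    (pair g h).act (1 :: w) = 1 :: h.act w := rfl

theorem ext_cons {g h : TreeAut (Fin 2)} (h0 : ∀ w, g.act (0 :: w) = h.act (0 :: w))
    (h1 : ∀ w, g.act (1 :: w) = h.act (1 :: w)) : g = h := by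
  ext1 v
  rcases v with _ | ⟨x, w⟩
  · rw [act_nil, act_nil]
  · fin_cases x
    · exact h0 w
    · exact h1 w

@[simp] theorem pair_mul (g h g' h' : TreeAut (Fin 2)) :
    pair g h * pair g' h' = pair (g * g') (h * h') :=
  ext_cons (fun _ => rfl) (fun _ => rfl)

@[simp] theorem pair_one_one : pair 1 1 = 1 :=
  ext_cons (fun _ => rfl) (fun _ => rfl)

theorem pair_inv (g h : TreeAut (Fin 2)) : (pair g h)⁻¹ = pair g⁻¹ h⁻¹ := by
  rw [inv_eq_iff_mul_eq_one, pair_mul, mul_inv_cancel, mul_inv_cancel, pair_one_one]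

theorem pair_pow (g h : TreeAut (Fin 2)) (n : ℕ) : pair g h ^ n = pair (g ^ n) (h ^ n) := by
  induction n with
  | zero => simp
  | succ n ih => rw [pow_succ, ih, pair_mul, pow_succ, pow_succ]

theorem pair_injective {g h g' h' : TreeAut (Fin 2)} (H : pair g h = pair g' h') :
    g = g' ∧ h = h' := by
  constructor <;> ext1 w
  · have := congrArg (fun k => TreeAut.act k (0 :: w)) H
    simpa using this
  · have := congrArg (fun k => TreeAut.act k (1 :: w)) H
    simpa using this

/-! ### The generators and their relations -/

/-- The generator `a = (1, 1)σ` of the Grigorchuk group. -/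
noncomputable def α : TreeAut (Fin 2) := Automaton.stateAut grigAutomaton_isInvertible .a

/-- The generator `b = (a, c)` of the Grigorchuk group. -/
noncomputable def β : TreeAut (Fin 2) := Automaton.stateAut grigAutomaton_isInvertible .b

/-- The generator `c = (a, d)` of the Grigorchuk group. -/
noncomputable def γ : TreeAut (Fin 2) := Automaton.stateAut grigAutomaton_isInvertible .c

/-- The generator `d = (1, b)` of the Grigorchuk group. -/
noncomputable def δ : TreeAut (Fin 2) := Automaton.stateAut grigAutomaton_isInvertible .d

/-- The generator `b = (d, d)` of the group of the four-state automaton. -/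
noncomputable def B : TreeAut (Fin 2) := Automaton.stateAut brotherAutomaton_isInvertible .b

theorem stateAut_e : Automaton.stateAut grigAutomaton_isInvertible .e = 1 := by
  ext1 v
  rw [Automaton.stateAut_act, one_act]
  induction v with
  | nil => rfl
  | cons x w ih => rw [Automaton.run]; exact congrArg (x :: ·) ih

theorem e_act (w : List (Fin 2)) : grigAutomaton.run .e w = w :=
  congrArg (fun g => TreeAut.act g w) stateAut_e

@[simp] theorem α_act_zero (w : List (Fin 2)) : α.act (0 :: w) = 1 :: w :=
  congrArg (1 :: ·) (e_act w)

@[simp] theorem α_act_one (w : List (Fin 2)) : α.act (1 :: w) = 0 :: w :=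
  congrArg (0 :: ·) (e_act w)

theorem β_eq : β = pair α γ := ext_cons (fun _ => rfl) (fun _ => rfl)

theorem γ_eq : γ = pair α δ := ext_cons (fun _ => rfl) (fun _ => rfl)

theorem δ_eq : δ = pair 1 β :=
  ext_cons (fun w => congrArg (0 :: ·) (e_act w)) (fun _ => rfl)

@[simp] theorem β_act_zero (w : List (Fin 2)) : β.act (0 :: w) = 0 :: α.act w := rfl
@[simp] theorem β_act_one (w : List (Fin 2)) : β.act (1 :: w) = 1 :: γ.act w := rfl
@[simp] theorem γ_act_zero (w : List (Fin 2)) : γ.act (0 :: w) = 0 :: α.act w := rfl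
@[simp] theorem γ_act_one (w : List (Fin 2)) : γ.act (1 :: w) = 1 :: δ.act w := rfl
@[simp] theorem δ_act_zero (w : List (Fin 2)) : δ.act (0 :: w) = 0 :: w :=
  congrArg (0 :: ·) (e_act w)
@[simp] theorem δ_act_one (w : List (Fin 2)) : δ.act (1 :: w) = 1 :: β.act w := rfl

theorem α_mul_self : α * α = 1 := ext_cons (by simp) (by simp)

theorem α_mul_pair (g h : TreeAut (Fin 2)) : α * pair g h = pair h g * α :=
  ext_cons (by simp) (by simp)

/-- The set `{1, β, γ, δ}` is a Klein four-group. The sections of these six relations are again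
such relations, so that they hold by induction on the level. -/
theorem klein_act (v : List (Fin 2)) :
    (β.act (β.act v) = v ∧ γ.act (γ.act v) = v ∧ δ.act (δ.act v) = v) ∧
    β.act (γ.act v) = δ.act v ∧ γ.act (δ.act v) = β.act v ∧ δ.act (β.act v) = γ.act v := by
  have hα (w) : α.act (α.act w) = w := congrArg (fun g => TreeAut.act g w) α_mul_self
  induction v with
  | nil => simp
  | cons x w ih =>
    obtain ⟨⟨h1, h2, h3⟩, h4, h5, h6⟩ := ih
    fin_cases x <;> simp [hα, h1, h2, h3, h4, h5, h6]

theorem β_mul_self : β * β = 1 := by ext1 v; exact (klein_act v).1.1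
theorem γ_mul_self : γ * γ = 1 := by ext1 v; exact (klein_act v).1.2.1
theorem δ_mul_self : δ * δ = 1 := by ext1 v; exact (klein_act v).1.2.2
theorem β_mul_γ : β * γ = δ := by ext1 v; exact (klein_act v).2.1
theorem γ_mul_δ : γ * δ = β := by ext1 v; exact (klein_act v).2.2.1
theorem δ_mul_β : δ * β = γ := by ext1 v; exact (klein_act v).2.2.2

theorem γ_mul_β : γ * β = δ := by rw [← δ_mul_β, mul_assoc, β_mul_self, mul_one]
theorem δ_mul_γ : δ * γ = β := by rw [← β_mul_γ, mul_assoc, γ_mul_self, mul_one]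
theorem β_mul_δ : β * δ = γ := by rw [← γ_mul_δ, mul_assoc, δ_mul_self, mul_one]

theorem mul_mul_of_eq {g h k : TreeAut (Fin 2)} (H : g * h = k) (w : TreeAut (Fin 2)) :
    g * (h * w) = k * w := by rw [← mul_assoc, H]

theorem mul_mul_of_eq_one {g h : TreeAut (Fin 2)} (H : g * h = 1) (w : TreeAut (Fin 2)) :
    g * (h * w) = w := by rw [← mul_assoc, H, one_mul]

theorem α_inv : α⁻¹ = α := inv_eq_of_mul_eq_one_right α_mul_self
theorem β_inv : β⁻¹ = β := inv_eq_of_mul_eq_one_right β_mul_self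
theorem γ_inv : γ⁻¹ = γ := inv_eq_of_mul_eq_one_right γ_mul_self
theorem δ_inv : δ⁻¹ = δ := inv_eq_of_mul_eq_one_right δ_mul_self

@[simp] theorem α_mul_α_mul (w) : α * (α * w) = w := mul_mul_of_eq_one α_mul_self w
@[simp] theorem β_mul_β_mul (w) : β * (β * w) = w := mul_mul_of_eq_one β_mul_self w
@[simp] theorem γ_mul_γ_mul (w) : γ * (γ * w) = w := mul_mul_of_eq_one γ_mul_self w
@[simp] theorem δ_mul_δ_mul (w) : δ * (δ * w) = w := mul_mul_of_eq_one δ_mul_self w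
@[simp] theorem β_mul_γ_mul (w) : β * (γ * w) = δ * w := mul_mul_of_eq β_mul_γ w
@[simp] theorem γ_mul_β_mul (w) : γ * (β * w) = δ * w := mul_mul_of_eq γ_mul_β w
@[simp] theorem γ_mul_δ_mul (w) : γ * (δ * w) = β * w := mul_mul_of_eq γ_mul_δ w
@[simp] theorem δ_mul_γ_mul (w) : δ * (γ * w) = β * w := mul_mul_of_eq δ_mul_γ w
@[simp] theorem δ_mul_β_mul (w) : δ * (β * w) = γ * w := mul_mul_of_eq δ_mul_β w
@[simp] theorem β_mul_δ_mul (w) : β * (δ * w) = γ * w := mul_mul_of_eq β_mul_δ w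

attribute [simp] α_mul_self β_mul_self γ_mul_self δ_mul_self β_mul_γ γ_mul_β γ_mul_δ δ_mul_γ
  β_mul_δ δ_mul_β α_inv β_inv γ_inv δ_inv

theorem α_mul_pair_mul (g h w : TreeAut (Fin 2)) :
    α * (pair g h * w) = pair h g * (α * w) := by
  rw [← mul_assoc, α_mul_pair, mul_assoc]

theorem pair_mul_pair_mul (g h g' h' w : TreeAut (Fin 2)) :
    pair g h * (pair g' h' * w) = pair (g * g') (h * h') * w := by
  rw [← mul_assoc, pair_mul]

/-- The states of the four-state automaton differ by elements of the Grigorchuk group. -/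
theorem brother_run (v : List (Fin 2)) :
    brotherAutomaton.run .a v = α.act (brotherAutomaton.run .d v) ∧
    brotherAutomaton.run .b v = δ.act (brotherAutomaton.run .c v) ∧
    brotherAutomaton.run .c v = γ.act (brotherAutomaton.run .d v) ∧
    brotherAutomaton.run .d v = β.act (brotherAutomaton.run .b v) := by
  have ha0 (w) : brotherAutomaton.run .a (0 :: w) = 1 :: brotherAutomaton.run .a w := rfl
  have ha1 (w) : brotherAutomaton.run .a (1 :: w) = 0 :: brotherAutomaton.run .c w := rfl
  have hb0 (w) : brotherAutomaton.run .b (0 :: w) = 0 :: brotherAutomaton.run .d w := rfl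
  have hb1 (w) : brotherAutomaton.run .b (1 :: w) = 1 :: brotherAutomaton.run .d w := rfl
  have hc0 (w) : brotherAutomaton.run .c (0 :: w) = 0 :: brotherAutomaton.run .d w := rfl
  have hc1 (w) : brotherAutomaton.run .c (1 :: w) = 1 :: brotherAutomaton.run .b w := rfl
  have hd0 (w) : brotherAutomaton.run .d (0 :: w) = 0 :: brotherAutomaton.run .a w := rfl
  have hd1 (w) : brotherAutomaton.run .d (1 :: w) = 1 :: brotherAutomaton.run .c w := rfl
  have hα (w) : α.act (α.act w) = w := congrArg (fun g => TreeAut.act g w) α_mul_self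
  induction v with
  | nil => simp [Automaton.run]
  | cons x w ih =>
    obtain ⟨ha, hb, hc, hd⟩ := ih
    fin_cases x <;>
      simp [ha0, ha1, hb0, hb1, hc0, hc1, hd0, hd1, hα, ha, ← hb, ← hc, ← hd]

theorem stateAut_d : Automaton.stateAut brotherAutomaton_isInvertible .d = β * B := by
  ext1 v; exact (brother_run v).2.2.2

theorem stateAut_a : Automaton.stateAut brotherAutomaton_isInvertible .a = α * (β * B) := by
  rw [← stateAut_d]; ext1 v; exact (brother_run v).1

theorem stateAut_c : Automaton.stateAut brotherAutomaton_isInvertible .c = δ * B := by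
  rw [← γ_mul_β, mul_assoc, ← stateAut_d]; ext1 v; exact (brother_run v).2.2.1

theorem B_eq : B = pair (β * B) (β * B) := by
  rw [← stateAut_d]; exact ext_cons (fun _ => rfl) (fun _ => rfl)

theorem B_mul_α : B * α = α * B := by rw [B_eq, α_mul_pair]

theorem α_mem : α ∈ grigorchukGroup := Subgroup.subset_closure ⟨_, rfl⟩
theorem β_mem : β ∈ grigorchukGroup := Subgroup.subset_closure ⟨_, rfl⟩
theorem γ_mem : γ ∈ grigorchukGroup := Subgroup.subset_closure ⟨_, rfl⟩
theorem δ_mem : δ ∈ grigorchukGroup := Subgroup.subset_closure ⟨_, rfl⟩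
theorem B_mem : B ∈ brotherGroup := Subgroup.subset_closure ⟨_, rfl⟩

theorem grigorchukGroup_le {H : Subgroup (TreeAut (Fin 2))} (ha : α ∈ H) (hb : β ∈ H)
    (hc : γ ∈ H) (hd : δ ∈ H) : grigorchukGroup ≤ H := by
  rw [grigorchukGroup, Automaton.group, Subgroup.closure_le]
  rintro _ ⟨q, rfl⟩
  cases q
  · rw [stateAut_e]; exact one_mem H
  exacts [ha, hb, hc, hd]

theorem brotherGroup_le {H : Subgroup (TreeAut (Fin 2))} (hH : grigorchukGroup ≤ H)
    (hB : B ∈ H) : brotherGroup ≤ H := by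
  rw [brotherGroup, Automaton.group, Subgroup.closure_le]
  rintro _ ⟨q, rfl⟩
  cases q
  · rw [stateAut_a]; exact mul_mem (hH α_mem) (mul_mem (hH β_mem) hB)
  · exact hB
  · rw [stateAut_c]; exact mul_mem (hH δ_mem) hB
  · rw [stateAut_d]; exact mul_mem (hH β_mem) hB

theorem grigorchukGroup_le_brotherGroup : grigorchukGroup ≤ brotherGroup := by
  have hd : Automaton.stateAut brotherAutomaton_isInvertible .d ∈ brotherGroup :=
    Subgroup.subset_closure ⟨_, rfl⟩
  have ha : Automaton.stateAut brotherAutomaton_isInvertible .a ∈ brotherGroup :=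
    Subgroup.subset_closure ⟨_, rfl⟩
  have hc : Automaton.stateAut brotherAutomaton_isInvertible .c ∈ brotherGroup :=
    Subgroup.subset_closure ⟨_, rfl⟩
  rw [stateAut_d, Subgroup.mul_mem_cancel_right _ B_mem] at hd
  rw [stateAut_c, Subgroup.mul_mem_cancel_right _ B_mem] at hc
  rw [stateAut_a, Subgroup.mul_mem_cancel_right _ (mul_mem hd B_mem)] at ha
  refine grigorchukGroup_le ha hd ?_ hc
  rw [← δ_mul_β]
  exact mul_mem hc hd

/-! ### Branching -/

/-- The normal closure in `H` of `(α β)²`: the subgroup generated by its conjugates by elements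
of `H`. -/
def branchSubgroup (H : Subgroup (TreeAut (Fin 2))) : Subgroup (TreeAut (Fin 2)) :=
  Subgroup.closure {k | ∃ h ∈ H, k = h * (α * β * (α * β)) * h⁻¹}

theorem branchSubgroup_le {H : Subgroup (TreeAut (Fin 2))} (hH : grigorchukGroup ≤ H) :
    branchSubgroup H ≤ H := by
  rw [branchSubgroup, Subgroup.closure_le]
  rintro _ ⟨h, hh, rfl⟩
  have := mul_mem (hH α_mem) (hH β_mem)
  exact mul_mem (mul_mem hh (mul_mem this this)) (inv_mem hh)

theorem conj_mem_branchSubgroup {H : Subgroup (TreeAut (Fin 2))} {g k : TreeAut (Fin 2)}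
    (hg : g ∈ H) (hk : k ∈ branchSubgroup H) : g * k * g⁻¹ ∈ branchSubgroup H := by
  have : (branchSubgroup H).map (MulAut.conj g).toMonoidHom ≤ branchSubgroup H := by
    rw [branchSubgroup, MonoidHom.map_closure, Subgroup.closure_le]
    rintro _ ⟨_, ⟨h, hh, rfl⟩, rfl⟩
    refine Subgroup.subset_closure ⟨g * h, mul_mem hg hh, ?_⟩
    simp [mul_assoc]
  exact this ⟨k, hk, rfl⟩

theorem sq_mem_branchSubgroup (H : Subgroup (TreeAut (Fin 2))) :
    α * β * (α * β) ∈ branchSubgroup H :=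
  Subgroup.subset_closure ⟨1, one_mem H, by simp⟩

theorem sq_eq_pair : α * β * (α * β) = pair (γ * α) (α * γ) := by
  have h : α * β = pair γ α * α := by rw [← α_mul_pair, ← β_eq]
  rw [h, mul_assoc, α_mul_pair_mul, α_mul_self, mul_one, pair_mul]

/-- The second coordinates of the elements `(g, h)` of `H`. -/
def sndSections (H : Subgroup (TreeAut (Fin 2))) : Subgroup (TreeAut (Fin 2)) where
  carrier := {h | ∃ g, pair g h ∈ H}
  one_mem' := ⟨1, by rw [pair_one_one]; exact one_mem H⟩
  mul_mem' := by
    rintro _ _ ⟨g, hg⟩ ⟨g', hg'⟩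
    exact ⟨g * g', by rw [← pair_mul]; exact mul_mem hg hg'⟩
  inv_mem' := by
    rintro _ ⟨g, hg⟩
    exact ⟨g⁻¹, by rw [← pair_inv]; exact inv_mem hg⟩

theorem grigorchukGroup_le_sndSections {H : Subgroup (TreeAut (Fin 2))}
    (hH : grigorchukGroup ≤ H) : grigorchukGroup ≤ sndSections H := by
  refine grigorchukGroup_le ⟨δ, ?_⟩ ⟨1, ?_⟩ ⟨α, ?_⟩ ⟨α, ?_⟩
  · have : pair δ α = α * γ * α := by
      rw [γ_eq, α_mul_pair, mul_assoc, α_mul_self, mul_one]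
    rw [this]
    exact mul_mem (mul_mem (hH α_mem) (hH γ_mem)) (hH α_mem)
  · rw [← δ_eq]; exact hH δ_mem
  · rw [← β_eq]; exact hH β_mem
  · rw [← γ_eq]; exact hH γ_mem

theorem brotherGroup_le_sndSections : brotherGroup ≤ sndSections brotherGroup := by
  refine brotherGroup_le (grigorchukGroup_le_sndSections grigorchukGroup_le_brotherGroup)
    ⟨β * B, ?_⟩
  have : pair (β * B) B = δ * B := by
    conv_rhs => rw [B_eq, δ_eq]
    simp
  rw [this]
  exact mul_mem (grigorchukGroup_le_brotherGroup δ_mem) B_mem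

/-- Write `t = (α β)² = (γ α, α γ)`. Since `δ = (1, β)`, the commutator `t⁻¹ δ t δ` has trivial
first coordinate, and conjugation by `β` turns it into `(1, t)`. -/
theorem pair_one_sq_mem {H : Subgroup (TreeAut (Fin 2))} (hH : grigorchukGroup ≤ H) :
    pair 1 (α * β * (α * β)) ∈ branchSubgroup H := by
  have ht := sq_mem_branchSubgroup H
  have h : pair 1 (α * β * (α * β)) =
      β * ((α * β * (α * β))⁻¹ * (δ * (α * β * (α * β)) * δ⁻¹)) * β⁻¹ := by
    rw [sq_eq_pair, pair_inv, δ_inv, β_inv]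
    conv_rhs => rw [δ_eq, pair_mul, pair_mul, pair_mul, β_eq, pair_mul, pair_mul, ← β_eq]
    simp [mul_assoc, ← sq_eq_pair]
  rw [h]
  exact conj_mem_branchSubgroup (hH β_mem)
    (mul_mem (inv_mem ht) (conj_mem_branchSubgroup (hH δ_mem) ht))

/-- If every element of `H` is the second coordinate of an element of `H`, then the conjugates
`(1, h t h⁻¹)` of `(1, t)`, where `t = (α β)²`, lie in the normal closure of `t`. -/
theorem pair_one_mem_branchSubgroup {H : Subgroup (TreeAut (Fin 2))} (hH : grigorchukGroup ≤ H)
    (hs : H ≤ sndSections H) {k : TreeAut (Fin 2)} (hk : k ∈ branchSubgroup H) :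
    pair 1 k ∈ branchSubgroup H := by
  refine Subgroup.closure_induction ?_ ?_ ?_ ?_ hk
  · rintro _ ⟨h, hh, rfl⟩
    obtain ⟨g, hg⟩ := hs hh
    have : pair 1 (h * (α * β * (α * β)) * h⁻¹) =
        pair g h * pair 1 (α * β * (α * β)) * (pair g h)⁻¹ := by
      simp [pair_inv]
    rw [this]
    exact conj_mem_branchSubgroup hg (pair_one_sq_mem hH)
  · rw [pair_one_one]; exact one_mem _
  · intro x y _ _ hx hy
    simpa using mul_mem hx hy
  · intro x _ hx
    simpa [pair_inv] using inv_mem hx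

theorem pair_self_mem_branchSubgroup {H : Subgroup (TreeAut (Fin 2))}
    (hH : grigorchukGroup ≤ H) (hs : H ≤ sndSections H) {k : TreeAut (Fin 2)}
    (hk : k ∈ branchSubgroup H) : pair k k ∈ branchSubgroup H := by
  have h1 := pair_one_mem_branchSubgroup hH hs hk
  have h2 := conj_mem_branchSubgroup (hH α_mem) h1
  rw [α_mul_pair, mul_inv_cancel_right] at h2
  simpa using mul_mem h2 h1

/-! ### The closures of the two groups -/

theorem pair_β_β : pair β β = δ * α * (δ * α) := by
  conv_rhs => rw [δ_eq, mul_assoc, α_mul_pair_mul, α_mul_self, mul_one, pair_mul]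
  rw [one_mul, mul_one]

theorem pair_β_β_mem : pair β β ∈ grigorchukGroup := by
  rw [pair_β_β]
  exact mul_mem (mul_mem δ_mem α_mem) (mul_mem δ_mem α_mem)

/-- With `h = (β, β)`, the element `(h, h)` is a product of two conjugates of `(α β)²`. -/
theorem pair_pair_β_mem :
    pair (pair β β) (pair β β) ∈ branchSubgroup grigorchukGroup := by
  have hsq : α * (δ * (α * δ)) = pair β β := by
    have h : pair β β * pair β β = 1 := by simp
    rw [← inv_eq_of_mul_eq_one_right h, pair_β_β]
    simp [mul_assoc]
  have h : pair (pair β β) (pair β β) =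
      (δ * α * (α * β * (α * β)) * (δ * α)⁻¹) *
        (pair β β * (δ * α * (α * β * (α * β)) * (δ * α)⁻¹) * (pair β β)⁻¹) := by
    have hc : δ * α * (α * β * (α * β)) * (δ * α)⁻¹ = pair (α * γ) (δ * (α * β)) := by
      rw [sq_eq_pair, mul_inv_rev, α_inv, δ_inv]
      simp only [mul_assoc, α_mul_pair_mul, α_mul_α_mul]
      conv_lhs => rw [δ_eq]
      simp [mul_assoc]
    rw [hc, pair_inv, β_inv, pair_mul, pair_mul, pair_mul]
    congr 1
    · rw [← hsq]; simp [mul_assoc]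
    · rw [pair_β_β]; simp [mul_assoc]
  rw [h]
  have hm := conj_mem_branchSubgroup (mul_mem δ_mem α_mem) (sq_mem_branchSubgroup grigorchukGroup)
  exact mul_mem hm (conj_mem_branchSubgroup pair_β_β_mem hm)

/-- Every level sees `B` as an element of the coset of `h = (β, β)` modulo the normal closure `K`
of `(α β)²` in the Grigorchuk group: if `B` agrees with `h k` on a level, then `B = (β B, β B)`
agrees with `(β h k, β h k) = h (h, h) (k, k)` on the next one. -/
theorem exists_act_eq_B_act (n : ℕ) : ∃ k ∈ branchSubgroup grigorchukGroup,
    ∀ v : List (Fin 2), v.length = n → (pair β β * k).act v = B.act v := by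
  induction n with
  | zero =>
    refine ⟨1, one_mem _, fun v hv => ?_⟩
    rw [List.eq_nil_of_length_eq_zero hv, act_nil, act_nil]
  | succ n ih =>
    obtain ⟨k, hk, h⟩ := ih
    refine ⟨pair (pair β β) (pair β β) * pair k k, mul_mem pair_pair_β_mem
      (pair_self_mem_branchSubgroup le_rfl (grigorchukGroup_le_sndSections le_rfl) hk), ?_⟩
    intro v hv
    rcases v with _ | ⟨x, w⟩
    · simp at hv
    · have hw := h w (by simpa using hv)
      rw [B_eq, pair_mul, pair_mul]
      fin_cases x <;> simp only [mul_act, Fin.mk_zero, Fin.mk_one, pair_act_zero,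
        pair_act_one] at hw ⊢ <;> rw [hw]

theorem mem_topologicalClosure_of_act_eq {X : Type*} {H : Subgroup (TreeAut X)} {g : TreeAut X}
    (h : ∀ n : ℕ, ∃ k ∈ H, ∀ v : List X, v.length = n → k.act v = g.act v) :
    g ∈ H.topologicalClosure := by
  change g ∈ closure (H : Set (TreeAut X))
  rw [mem_closure_iff_nhds_basis ((congruenceBasis X).nhds_hasBasis g)]
  rintro _ ⟨n, rfl⟩
  obtain ⟨k, hk, hn⟩ := h n
  refine ⟨k, hk, g⁻¹ * k, fun v hv => ?_, mul_inv_cancel_left g k⟩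
  rw [mul_act, hn v hv, inv_act_act]

theorem topologicalClosure_brotherGroup :
    brotherGroup.topologicalClosure = grigorchukGroup.topologicalClosure := by
  refine le_antisymm ?_ (closure_mono grigorchukGroup_le_brotherGroup)
  refine Subgroup.topologicalClosure_minimal _ (brotherGroup_le
    grigorchukGroup.le_topologicalClosure (mem_topologicalClosure_of_act_eq fun n => ?_))
    (Subgroup.isClosed_topologicalClosure _)
  obtain ⟨k, hk, h⟩ := exists_act_eq_B_act n
  exact ⟨_, mul_mem pair_β_β_mem (branchSubgroup_le le_rfl hk), h⟩

/-! ### Conjugates of the Grigorchuk generators -/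

/-- The conjugate `B β B⁻¹`. -/
noncomputable def conjβ : TreeAut (Fin 2) := B * β * B⁻¹

/-- The conjugate `B γ B⁻¹`. -/
noncomputable def conjγ : TreeAut (Fin 2) := B * γ * B⁻¹

/-- The conjugate `B δ B⁻¹`. -/
noncomputable def conjδ : TreeAut (Fin 2) := B * δ * B⁻¹

theorem conj_B_pair (g h : TreeAut (Fin 2)) :
    B * pair g h * B⁻¹ = pair (β * (B * g * B⁻¹) * β) (β * (B * h * B⁻¹) * β) := by
  conv_lhs => rw [B_eq, pair_inv]
  simp [mul_assoc]

theorem conj_B_α : B * α * B⁻¹ = α := by rw [B_mul_α, mul_inv_cancel_right]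

theorem conjβ_eq : conjβ = pair (β * α * β) (β * conjγ * β) := by
  rw [conjβ, β_eq, conj_B_pair, conj_B_α, ← conjγ, ← β_eq]

theorem conjγ_eq : conjγ = pair (β * α * β) (β * conjδ * β) := by
  rw [conjγ, γ_eq, conj_B_pair, conj_B_α, ← conjδ]

theorem conjδ_eq : conjδ = pair 1 (β * conjβ * β) := by
  rw [conjδ, δ_eq, conj_B_pair, ← conjβ]
  simp

/-! ### An element of infinite order -/

theorem mul_pow_eq_one_swap {G : Type*} [Group G] {g h : G} {n : ℕ} (H : (g * h) ^ n = 1) :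
    (h * g) ^ n = 1 := by
  have : h * g = h * (g * h) * h⁻¹ := by group
  rw [this, conj_pow, H, mul_one, mul_inv_cancel]

theorem pair_ne_pair_mul_α (g h g' h' : TreeAut (Fin 2)) : pair g h ≠ pair g' h' * α := by
  intro H
  have := congrArg (fun k => TreeAut.act k [0]) H
  simp at this

theorem pair_mul_α_sq (g h : TreeAut (Fin 2)) :
    (pair g h * α) ^ 2 = pair (g * h) (h * g) := by
  rw [sq, mul_assoc, α_mul_pair_mul, α_mul_self, mul_one, pair_mul]

/-- If `(g, h)σ` has finite order, then this order is twice that of `g h`. -/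
theorem pair_mul_α_pow_eq_one {g h : TreeAut (Fin 2)} {n : ℕ} (H : (pair g h * α) ^ n = 1) :
    ∃ m, n = 2 * m ∧ (g * h) ^ m = 1 := by
  rcases Nat.even_or_odd' n with ⟨m, rfl | rfl⟩
  · rw [pow_mul, pair_mul_α_sq, pair_pow, ← pair_one_one] at H
    exact ⟨m, rfl, (pair_injective H).1⟩
  · rw [pow_succ, pow_mul, pair_mul_α_sq, pair_pow, ← mul_assoc, pair_mul, ← pair_one_one] at H
    exact absurd H.symm (pair_ne_pair_mul_α _ _ _ _)

theorem pair_pow_eq_one {g h : TreeAut (Fin 2)} {n : ℕ} (H : pair g h ^ n = 1) : h ^ n = 1 := by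
  rw [pair_pow, ← pair_one_one] at H
  exact (pair_injective H).2

theorem δ_mul_conjδ : δ * conjδ = pair 1 (conjβ * β) := by
  rw [conjδ_eq,
    show δ * pair 1 (β * conjβ * β) = pair 1 β * pair 1 (β * conjβ * β) by rw [← δ_eq]]
  simp [mul_assoc]

theorem β_α_pow_four : β * (α * (β * (α * (β * (α * (β * α)))))) =
    pair (α * (γ * (α * γ))) (γ * (α * (γ * α))) := by
  have h : β * (α * (β * α)) = pair (α * γ) (γ * α) := by
    rw [← inv_inj, pair_inv]
    simpa [mul_assoc] using sq_eq_pair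
  have h' : β * (α * (β * (α * (β * (α * (β * α)))))) =
      β * (α * (β * α)) * (β * (α * (β * α))) := by simp only [mul_assoc]
  rw [h', h, pair_mul, mul_assoc, mul_assoc]

/-- If `g = conjγ α γ conjγ γ` has order dividing `n`, then `n` is even, and the variant of `g`
with `β` in place of the first `γ` has order dividing `n / 2`: up to conjugation, this variant is
a section of `g²`. -/
theorem pow_eq_one_of_γ {n : ℕ} (H : (conjγ * (α * (γ * (conjγ * γ)))) ^ n = 1) :
    ∃ m, n = 2 * m ∧ (conjγ * (α * (β * (conjγ * γ)))) ^ m = 1 := by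
  have h1 : conjγ * (α * (γ * (conjγ * γ))) =
      pair (β * (α * (δ * (conjδ * γ)))) (β * (conjδ * (β * (α * (β * (α * (β * α))))))) * α := by
    conv_lhs => rw [conjγ_eq, γ_eq]
    simp [mul_assoc, α_mul_pair, pair_mul_pair_mul]
  rw [h1] at H
  obtain ⟨m, rfl, K⟩ := pair_mul_α_pow_eq_one H
  refine ⟨m, rfl, ?_⟩
  -- Conjugation by `β * α` brings out the factor `(β α)⁴`, whose sections are short.
  have h2 : β * (α * (δ * (conjδ * γ))) * (β * (conjδ * (β * (α * (β * (α * (β * α))))))) =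
      β * α * (δ * (conjδ * (δ * (conjδ * (β * (α * (β * (α * (β * α))))))))) := by
    simp [mul_assoc]
  rw [h2] at K
  replace K := mul_pow_eq_one_swap K
  have h3 : δ * (conjδ * (δ * (conjδ * (β * (α * (β * (α * (β * α)))))))) * (β * α) =
      pair (α * (γ * (α * γ))) (conjβ * (β * (conjβ * (δ * (α * (γ * α)))))) := by
    simp only [mul_assoc]
    rw [β_α_pow_four, ← mul_assoc δ conjδ, ← mul_assoc δ conjδ, δ_mul_conjδ]
    simp [mul_assoc]
  rw [h3] at K
  replace K := pair_pow_eq_one K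
  -- The recursions are folded from right to left: the sections of a generator mention other
  -- generators, which unfolding would expand as well.
  have h4 : conjβ * (β * (conjβ * (δ * (α * (γ * α))))) =
      pair (β * (α * (β * (α * (β * (α * γ)))))) (β * (conjγ * γ) * (conjγ * α)) :=
    calc conjβ * (β * (conjβ * (δ * (α * (γ * α))))) =
        pair (β * α * β) (β * conjγ * β) * (pair α γ * (pair (β * α * β) (β * conjγ * β) *
          (pair 1 β * (α * (pair α δ * α))))) := by
          rw [← conjβ_eq, ← δ_eq, ← γ_eq, ← β_eq]
      _ = _ := by
          simp [mul_assoc, α_mul_pair_mul]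
  rw [h4] at K
  replace K := mul_pow_eq_one_swap (pair_pow_eq_one K)
  simpa [mul_assoc] using K

/-- The step back from `conjγ α β conjγ γ`: a section of its square is conjugate to
`conjγ α γ conjγ γ`. -/
theorem pow_eq_one_of_β {n : ℕ} (H : (conjγ * (α * (β * (conjγ * γ)))) ^ n = 1) :
    ∃ m, n = 2 * m ∧ (conjγ * (α * (γ * (conjγ * γ)))) ^ m = 1 := by
  have h1 : conjγ * (α * (β * (conjγ * γ))) =
      pair (β * (α * (γ * (conjδ * γ)))) (β * (conjδ * (β * (α * (β * (α * (β * α))))))) * α :=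
    calc conjγ * (α * (β * (conjγ * γ))) = pair (β * α * β) (β * conjδ * β) * (α * (pair α γ *
        (pair (β * α * β) (β * conjδ * β) * pair α δ))) := by
          rw [← conjγ_eq, ← γ_eq, ← β_eq]
      _ = _ := by simp [mul_assoc, α_mul_pair, pair_mul_pair_mul]
  rw [h1] at H
  obtain ⟨m, rfl, K⟩ := pair_mul_α_pow_eq_one H
  refine ⟨m, rfl, ?_⟩
  -- Conjugation by `β * α` brings out the factor `(β α)⁴`, whose sections are short.
  have h2 : β * (α * (γ * (conjδ * γ))) * (β * (conjδ * (β * (α * (β * (α * (β * α))))))) =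
      β * α * (β * (δ * (conjδ * (δ * (conjδ * (β * (α * (β * (α * (β * α)))))))))) := by
    simp [mul_assoc]
  rw [h2] at K
  replace K := mul_pow_eq_one_swap K
  have h3 : β * (δ * (conjδ * (δ * (conjδ * (β * (α * (β * (α * (β * α))))))))) * (β * α) =
      pair (α * (α * (γ * (α * γ)))) (γ * (conjβ * (β * (conjβ * (δ * (α * (γ * α))))))) := by
    simp only [mul_assoc]
    rw [β_α_pow_four, ← mul_assoc δ conjδ, ← mul_assoc δ conjδ, δ_mul_conjδ,
      show ∀ w, β * w = pair α γ * w by rw [← β_eq]; exact fun _ => rfl]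
    simp [mul_assoc]
  rw [h3] at K
  replace K := mul_pow_eq_one_swap (pair_pow_eq_one K)
  have h4 : conjβ * (β * (conjβ * (δ * (α * (γ * α))))) * γ =
      pair (β * (α * (β * (α * (β * (α * (γ * α))))))) (β * (conjγ * γ) * (conjγ * (α * δ))) :=
    calc conjβ * (β * (conjβ * (δ * (α * (γ * α))))) * γ =
        pair (β * α * β) (β * conjγ * β) * (pair α γ * (pair (β * α * β) (β * conjγ * β) *
          (pair 1 β * (α * (pair α δ * α))))) * pair α δ := by
          rw [← conjβ_eq, ← δ_eq, ← γ_eq, ← β_eq]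
      _ = _ := by
          simp [mul_assoc, α_mul_pair_mul]
  rw [h4] at K
  replace K := mul_pow_eq_one_swap (pair_pow_eq_one K)
  simpa [mul_assoc] using K

theorem conjγ_word_pow_ne_one (n : ℕ) (hn : 0 < n) :
    (conjγ * (α * (γ * (conjγ * γ)))) ^ n ≠ 1 := by
  induction n using Nat.strong_induction_on with
  | _ n ih =>
    intro H
    obtain ⟨m, rfl, Hm⟩ := pow_eq_one_of_γ H
    obtain ⟨k, rfl, Hk⟩ := pow_eq_one_of_β Hm
    exact ih k (by omega) (by omega) Hk

theorem not_isMulTorsion_brotherGroup : ¬ IsMulTorsion brotherGroup := by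
  intro h
  have hle := grigorchukGroup_le_brotherGroup
  have hconjγ : conjγ ∈ brotherGroup := mul_mem (mul_mem B_mem (hle γ_mem)) (inv_mem B_mem)
  obtain ⟨n, hn, H⟩ := isOfFinOrder_iff_pow_eq_one.1 (h ⟨conjγ * (α * (γ * (conjγ * γ))),
    mul_mem hconjγ (mul_mem (hle α_mem) (mul_mem (hle γ_mem) (mul_mem hconjγ (hle γ_mem))))⟩)
  exact conjγ_word_pow_ne_one n hn (congrArg Subtype.val H)

/-! ### The index of the Grigorchuk group -/

/-- `ContractsAt n g` holds if all sections of `g` at the vertices of level `n` belong to the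
nucleus `{1, α, β, γ, δ}` of the Grigorchuk group. -/
def ContractsAt : ℕ → TreeAut (Fin 2) → Prop
  | 0, g => g = 1 ∨ g = α ∨ g = β ∨ g = γ ∨ g = δ
  | n + 1, g => ∃ g₀ g₁, ContractsAt n g₀ ∧ ContractsAt n g₁ ∧
      (g = pair g₀ g₁ ∨ g = pair g₀ g₁ * α)

theorem ContractsAt.succ {n : ℕ} {g : TreeAut (Fin 2)} (hg : ContractsAt n g) :
    ContractsAt (n + 1) g := by
  induction n generalizing g with
  | zero =>
    rcases hg with rfl | rfl | rfl | rfl | rfl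
    · exact ⟨1, 1, by simp [ContractsAt], by simp [ContractsAt], by simp⟩
    · exact ⟨1, 1, by simp [ContractsAt], by simp [ContractsAt], by simp⟩
    · exact ⟨_, _, by simp [ContractsAt], by simp [ContractsAt], Or.inl β_eq⟩
    · exact ⟨_, _, by simp [ContractsAt], by simp [ContractsAt], Or.inl γ_eq⟩
    · exact ⟨_, _, by simp [ContractsAt], by simp [ContractsAt], Or.inl δ_eq⟩
  | succ n ih =>
    obtain ⟨g₀, g₁, h₀, h₁, h⟩ := hg
    exact ⟨g₀, g₁, ih h₀, ih h₁, h⟩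

theorem ContractsAt.mono {m n : ℕ} (hmn : m ≤ n) {g : TreeAut (Fin 2)} (hg : ContractsAt m g) :
    ContractsAt n g := by
  induction n, hmn using Nat.le_induction with
  | base => exact hg
  | succ n _ ih => exact ih.succ

theorem ContractsAt.mul {n : ℕ} {g h : TreeAut (Fin 2)} (hg : ContractsAt n g)
    (hh : ContractsAt n h) : ContractsAt (n + 1) (g * h) := by
  induction n generalizing g h with
  | zero =>
    have key : ∀ s, ContractsAt 0 s → ContractsAt 1 (α * s) := by
      intro s hs
      obtain ⟨g₀, g₁, h₀, h₁, h | h⟩ := hs.succ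
      · exact ⟨g₁, g₀, h₁, h₀, Or.inr (by rw [h, α_mul_pair])⟩
      · exact ⟨g₁, g₀, h₁, h₀, Or.inl (by
          rw [h, α_mul_pair_mul, α_mul_self, mul_one])⟩
    have key' : ∀ s, ContractsAt 0 s → ContractsAt 1 (s * α) := by
      intro s hs
      obtain ⟨g₀, g₁, h₀, h₁, h | h⟩ := hs.succ
      · exact ⟨g₀, g₁, h₀, h₁, Or.inr (by rw [h])⟩
      · exact ⟨g₀, g₁, h₀, h₁, Or.inl (by rw [h, mul_assoc, α_mul_self, mul_one])⟩
    rcases eq_or_ne g α with rfl | hgα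
    · exact key h hh
    rcases eq_or_ne h α with rfl | hhα
    · exact key' g hg
    refine ContractsAt.succ (n := 0) ?_
    rcases hg with rfl | rfl | rfl | rfl | rfl <;> rcases hh with rfl | rfl | rfl | rfl | rfl <;>
      first
        | exact absurd rfl hgα
        | exact absurd rfl hhα
        | simp [ContractsAt]
  | succ n ih =>
    obtain ⟨g₀, g₁, hg₀, hg₁, rfl | rfl⟩ := hg <;> obtain ⟨h₀, h₁, hh₀, hh₁, rfl | rfl⟩ := hh
    · exact ⟨_, _, ih hg₀ hh₀, ih hg₁ hh₁, Or.inl (by simp)⟩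
    · exact ⟨_, _, ih hg₀ hh₀, ih hg₁ hh₁, Or.inr (by simp [pair_mul_pair_mul])⟩
    · exact ⟨_, _, ih hg₀ hh₁, ih hg₁ hh₀, Or.inr (by
        rw [mul_assoc, α_mul_pair, pair_mul_pair_mul])⟩
    · exact ⟨_, _, ih hg₀ hh₁, ih hg₁ hh₀, Or.inl (by
        rw [mul_assoc, α_mul_pair_mul, α_mul_self, mul_one, pair_mul])⟩

theorem ContractsAt.inv {n : ℕ} {g : TreeAut (Fin 2)} (hg : ContractsAt n g) :
    ContractsAt n g⁻¹ := by
  induction n generalizing g with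
  | zero => rcases hg with rfl | rfl | rfl | rfl | rfl <;> simp [ContractsAt]
  | succ n ih =>
    obtain ⟨g₀, g₁, h₀, h₁, rfl | rfl⟩ := hg
    · exact ⟨_, _, ih h₀, ih h₁, Or.inl (pair_inv _ _)⟩
    · exact ⟨_, _, ih h₁, ih h₀, Or.inr (by
        rw [mul_inv_rev, α_inv, pair_inv, α_mul_pair])⟩

/-- The automorphisms whose sections at all vertices of some level belong to the nucleus of the
Grigorchuk group. -/
def contractingSubgroup : Subgroup (TreeAut (Fin 2)) where
  carrier := {g | ∃ n, ContractsAt n g}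
  one_mem' := ⟨0, Or.inl rfl⟩
  mul_mem' := by
    rintro g h ⟨m, hg⟩ ⟨n, hh⟩
    exact ⟨_, (hg.mono (le_max_left m n)).mul (hh.mono (le_max_right m n))⟩
  inv_mem' := by
    rintro g ⟨n, hg⟩
    exact ⟨n, hg.inv⟩

theorem grigorchukGroup_le_contractingSubgroup : grigorchukGroup ≤ contractingSubgroup :=
  grigorchukGroup_le ⟨0, by simp [ContractsAt]⟩ ⟨0, by simp [ContractsAt]⟩
    ⟨0, by simp [ContractsAt]⟩ ⟨0, by simp [ContractsAt]⟩

theorem ContractsAt.of_pair {n : ℕ} {g h : TreeAut (Fin 2)} (H : ContractsAt (n + 1) (pair g h)) :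
    ContractsAt n g ∧ ContractsAt n h := by
  obtain ⟨g₀, g₁, h₀, h₁, h | h⟩ := H
  · obtain ⟨rfl, rfl⟩ := pair_injective h
    exact ⟨h₀, h₁⟩
  · exact absurd h (pair_ne_pair_mul_α _ _ _ _)

theorem of_pair_mem_contractingSubgroup {g h : TreeAut (Fin 2)}
    (H : pair g h ∈ contractingSubgroup) : g ∈ contractingSubgroup ∧ h ∈ contractingSubgroup := by
  obtain ⟨n, hn⟩ := H
  exact ⟨⟨n, hn.succ.of_pair.1⟩, ⟨n, hn.succ.of_pair.2⟩⟩

/-- The section of `conjγ` at the vertex `222` is `conjγ` itself. -/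
theorem ContractsAt.of_add_three {n : ℕ} (H : ContractsAt (n + 3) conjγ) :
    ContractsAt n conjγ := by
  rw [conjγ_eq] at H
  have H := H.of_pair.2
  have h : β * conjδ * β = pair 1 (δ * conjβ * δ) :=
    calc β * conjδ * β = pair α γ * pair 1 (β * conjβ * β) * pair α γ := by
          rw [← conjδ_eq, ← β_eq]
      _ = _ := by simp [mul_assoc]
  rw [h] at H
  have H := H.of_pair.2
  have h : δ * conjβ * δ = pair (β * α * β) conjγ :=
    calc δ * conjβ * δ = pair 1 β * pair (β * α * β) (β * conjγ * β) * pair 1 β := by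
          rw [← conjβ_eq, ← δ_eq]
      _ = _ := by simp [mul_assoc]
  rw [h] at H
  exact H.of_pair.2

theorem not_contractsAt_zero_conjγ : ¬ ContractsAt 0 conjγ := by
  have h0 : conjγ.act [0, 0, 0] = [0, 1, 1] := by simp [conjγ_eq]
  rintro (h | h | h | h | h) <;> simp [h] at h0

theorem conjγ_notMem_contractingSubgroup : conjγ ∉ contractingSubgroup := by
  rintro ⟨n, hn⟩
  have key : ∀ n, ¬ ContractsAt (3 * n) conjγ := by
    intro n
    induction n with
    | zero => exact not_contractsAt_zero_conjγ
    | succ n ih => exact fun H => ih H.of_add_three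
  exact key n (hn.mono (by omega))

/-- The conjugate of `(α β)²` by `B`, moved to the vertex `2ⁿ`; the other sections at level `n`
are trivial. -/
noncomputable def deepConj (n : ℕ) : TreeAut (Fin 2) :=
  (pair 1)^[n] (B * (α * β * (α * β)) * B⁻¹)

theorem deepConj_succ (n : ℕ) : deepConj (n + 1) = pair 1 (deepConj n) :=
  Function.iterate_succ_apply' _ _ _

theorem deepConj_mem_branchSubgroup (n : ℕ) : deepConj n ∈ branchSubgroup brotherGroup := by
  induction n with
  | zero => exact conj_mem_branchSubgroup B_mem (sq_mem_branchSubgroup _)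
  | succ n ih =>
    rw [deepConj_succ]
    exact pair_one_mem_branchSubgroup grigorchukGroup_le_brotherGroup
      brotherGroup_le_sndSections ih

/-- The section of `(deepConj m)⁻¹ * deepConj n` at the vertex `2ᵐ1` is that of
`(B (α β)² B⁻¹)⁻¹` at the letter `1`, which is `conjγ⁻¹` up to factors from the Grigorchuk
group. -/
theorem inv_deepConj_mul_notMem {m n : ℕ} (hmn : m < n) :
    (deepConj m)⁻¹ * deepConj n ∉ contractingSubgroup := by
  obtain ⟨n, rfl⟩ := Nat.exists_eq_add_one_of_ne_zero (Nat.ne_zero_of_lt hmn)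
  induction m generalizing n with
  | zero =>
    intro H
    have h : deepConj 0 = pair (β * (conjγ * α) * β) (β * (B * (α * γ) * B⁻¹) * β) := by
      change B * (α * β * (α * β)) * B⁻¹ = _
      have hc : B * (γ * α) * B⁻¹ = conjγ * α := by
        rw [← conj_mul, conj_B_α, conjγ]
      rw [sq_eq_pair, conj_B_pair, hc]
    rw [h, deepConj_succ, pair_inv, pair_mul] at H
    have H := (of_pair_mem_contractingSubgroup H).1
    rw [mul_one, inv_mem_iff] at H
    have hα := grigorchukGroup_le_contractingSubgroup α_mem
    have hβ := grigorchukGroup_le_contractingSubgroup β_mem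
    rw [Subgroup.mul_mem_cancel_right _ hβ, Subgroup.mul_mem_cancel_left _ hβ,
      Subgroup.mul_mem_cancel_right _ hα] at H
    exact conjγ_notMem_contractingSubgroup H
  | succ m ih =>
    intro H
    obtain ⟨n, rfl⟩ := Nat.exists_eq_add_one_of_ne_zero (show n ≠ 0 by omega)
    rw [deepConj_succ, deepConj_succ, pair_inv, pair_mul] at H
    exact ih n (by omega) (of_pair_mem_contractingSubgroup H).2

theorem infinite_quotient :
    Infinite (brotherGroup ⧸ grigorchukGroup.subgroupOf brotherGroup) := by
  have hmem (n : ℕ) : deepConj n ∈ brotherGroup :=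
    branchSubgroup_le grigorchukGroup_le_brotherGroup (deepConj_mem_branchSubgroup n)
  have key {m n : ℕ} (hmn : m < n) :
      ((⟨deepConj m, hmem m⟩ : brotherGroup) :
        brotherGroup ⧸ grigorchukGroup.subgroupOf brotherGroup) ≠
        (⟨deepConj n, hmem n⟩ : brotherGroup) := by
    intro h
    rw [QuotientGroup.eq, Subgroup.mem_subgroupOf] at h
    exact inv_deepConj_mul_notMem hmn (grigorchukGroup_le_contractingSubgroup h)
  refine Infinite.of_injective (fun n : ℕ => ((⟨deepConj n, hmem n⟩ : brotherGroup) :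
    brotherGroup ⧸ grigorchukGroup.subgroupOf brotherGroup)) fun m n h => ?_
  rcases lt_trichotomy m n with hmn | hmn | hmn
  · exact absurd h (key hmn)
  · exact hmn
  · exact absurd h.symm (key hmn)

end GrigBrother

open GrigBrother

theorem corollary1p7 :
    Nat.card GrigBrother.BrotherState = 4 ∧
    GrigBrother.grigorchukGroup ≤ GrigBrother.brotherGroup ∧
    GrigBrother.brotherGroup.topologicalClosure =
      GrigBrother.grigorchukGroup.topologicalClosure ∧
    ¬ IsMulTorsion ↥GrigBrother.brotherGroup ∧
    Infinite (↥GrigBrother.brotherGroup ⧸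
      GrigBrother.grigorchukGroup.subgroupOf GrigBrother.brotherGroup) := by
  refine ⟨?_, grigorchukGroup_le_brotherGroup, topologicalClosure_brotherGroup,
    not_isMulTorsion_brotherGroup, infinite_quotient⟩
  let e : BrotherState ≃ Fin 4 :=
    { toFun := fun | .a => 0 | .b => 1 | .c => 2 | .d => 3
      invFun := fun | 0 => .a | 1 => .b | 2 => .c | 3 => .d
      left_inv := by rintro (_ | _ | _ | _) <;> rfl
      right_inv := by intro i; fin_cases i <;> rfl }
  rw [Nat.card_congr e, Nat.card_fin]
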